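/- Let $N\ge 3$ be an integer, $\zeta_N=\exp(2\pi\sqrt{-1}/N)$, and let $F(N)=\{(X:Y:Z)\in\mathbb{C}P^2 : X^N+Y^N=Z^N\}$ be the Fermat curve, with affine coordinates $x=X/Z$, $y=Y/Z$ and automorphisms $\alpha(X:Y:Z)=(\zeta_N X:Y:Z)$, $\beta(X:Y:Z)=(X:\zeta_N Y:Z)$. Put $Q_j=\beta^j(0,1)$ in the coordinates $(x,y)$. Let $\gamma_0$ be the path $[0,1]\ni t\mapsto (x,y)=(t,\sqrt[N]{1-t^N})$, with the real nonnegative root. Writing $\ell_1\cdot\ell_2$ for the path that traverses $\ell_1$ first and then $\ell_2$, put $$\kappa_0=\gamma_0\cdot(\beta\gamma_0)^{-1}\cdot(\alpha\beta\gamma_0)\cdot(\alpha\gamma_0)^{-1},\qquad \gamma_j=\gamma_0\cdot(\beta^j\gamma_0)^{-1},\qquad \gamma_{i,j}=\gamma_j\cdot(\alpha^i\beta^j\kappa_0)\cdot\gamma_j^{-1}\qquad(i,j\in\mathbb{Z}),$$ where in $\gamma_{i,0}$ the conjugating path is $\gamma_0\cdot\gamma_0^{-1}$, the case $j=0$ of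 the formula for $\gamma_j$ (everywhere else $\gamma_0$ denotes the path above). Each $\gamma_{i,j}$ is a loop based at $Q_0$. For integers $r,s\ge 1$ with $r+s\le N-1$ let $$\omega_{r,s}=\frac{N}{B(r/N,s/N)}\,\frac{x^{r-1}y^{s-1}\,dx}{y^{N-1}},$$ where $B$ is the beta function. For a path $C$ and $1$-forms $\omega_1,\omega_2$ with $C^*\omega_k=f_k(t)\,dt$ on $[0,1]$, the iterated integral is $\int_C\omega_1\omega_2=\int_{0\le t_1\le t_2\le 1}f_1(t_1)f_2(t_2)\,dt_1dt_2$. Let $r,s,l,m\ge 1$ be integers with $r+s\le N-1$ and $l+m\le N-1$, and let $i,j\in\mathbb{Z}$. Then the iterated integrals $\int_{\gamma_0}\omega_{r,s}\omega_{l,m}$ and $\int_{\gamma_{i,j}}\omega_{r,s}\omega_{l,m}$ converge absolutely; the first one is the real number $$x_{r,s,l,m}=\frac{N^2}{B(r/N,s/N)\,B(l/N,m/N)}\int_{0\le t_1\le t_2\le 1}t_1^{r-1}\big(\sqrt[N]{1-t_1^N}\big)^{s-N}\,t_2^{l-1}\big(\sqrt[N]{1-t_2^N}\big)^{m-N}\,dt_1dt_2,$$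 and \begin{align*} \int_{\gamma_{i,j}}\omega_{r,s}\omega_{l,m}={}&\zeta_N^{i(r+l)+j(s+m)}\big\{(1-\zeta_N^{l+r})(1-\zeta_N^{m+s})\,x_{r,s,l,m}+(1-\zeta_N^s)(\zeta_N^{l+r}+\zeta_N^{l+m}-\zeta_N^m-\zeta_N^l)\big\}\\ &+(1-\zeta_N^{js})(1-\zeta_N^l)(1-\zeta_N^m)\,\zeta_N^{il+jm}-(1-\zeta_N^{jm})(1-\zeta_N^r)(1-\zeta_N^s)\,\zeta_N^{ir+js}. \end{align*} -/

import Mathlib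

noncomputable section

namespace FermatCurve

open MeasureTheory
open scoped unitInterval LinearAlgebra.Projectivization

/-- The complex projective plane `ℂP²`. -/
abbrev CP2 : Type := ℙ ℂ (Fin 3 → ℂ)

/-- `ℂP²` carries the quotient topology from `ℂ³ \ {0}`. -/
instance : TopologicalSpace CP2 :=
  TopologicalSpace.coinduced (Projectivization.mk' ℂ) inferInstance

/-- The Fermat curve `F(N) = {(X : Y : Z) ∈ ℂP² ; X ^ N + Y ^ N = Z ^ N}` (the equation does not
depend on the representative, see `mk_mem_curve`). -/
def curve (N : ℕ) : Set CP2 := {P | P.rep 0 ^ N + P.rep 1 ^ N = P.rep 2 ^ N}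

theorem mk_mem_curve (N : ℕ) (v : Fin 3 → ℂ) (hv : v ≠ 0) :
    Projectivization.mk ℂ v hv ∈ curve N ↔ v 0 ^ N + v 1 ^ N = v 2 ^ N := by
  obtain ⟨a, ha⟩ := Projectivization.exists_smul_eq_mk_rep ℂ v hv
  have ha0 : (a : ℂ) ^ N ≠ 0 := pow_ne_zero _ a.ne_zero
  simp only [curve, Set.mem_ofPred_eq, ← ha, Units.smul_def, Pi.smul_apply, smul_eq_mul, mul_pow,
    ← mul_add]
  exact mul_right_inj' ha0

/-- The affine coordinate `x = X / Z` on `F(N)` (with value `0` at the points at infinity). -/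
def x {N : ℕ} (p : curve N) : ℂ := p.1.rep 0 / p.1.rep 2

/-- The affine coordinate `y = Y / Z` on `F(N)` (with value `0` at the points at infinity). -/
def y {N : ℕ} (p : curve N) : ℂ := p.1.rep 1 / p.1.rep 2

theorem x_mk {N : ℕ} (v : Fin 3 → ℂ) (hv : v ≠ 0) (h : Projectivization.mk ℂ v hv ∈ curve N) :
    x (⟨Projectivization.mk ℂ v hv, h⟩ : curve N) = v 0 / v 2 := by
  obtain ⟨a, ha⟩ := Projectivization.exists_smul_eq_mk_rep ℂ v hv
  simp only [x, ← ha, Units.smul_def, Pi.smul_apply, smul_eq_mul]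
  exact mul_div_mul_left _ _ a.ne_zero

theorem y_mk {N : ℕ} (v : Fin 3 → ℂ) (hv : v ≠ 0) (h : Projectivization.mk ℂ v hv ∈ curve N) :
    y (⟨Projectivization.mk ℂ v hv, h⟩ : curve N) = v 1 / v 2 := by
  obtain ⟨a, ha⟩ := Projectivization.exists_smul_eq_mk_rep ℂ v hv
  simp only [y, ← ha, Units.smul_def, Pi.smul_apply, smul_eq_mul]
  exact mul_div_mul_left _ _ a.ne_zero

theorem affine_ne_zero (a b : ℂ) : (![a, b, 1] : Fin 3 → ℂ) ≠ 0 := fun h => by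
  simpa using congrFun h 2

/-- The point of `F(N)` with affine coordinates `(a, b)`, that is, `(a : b : 1)`. -/
def affine (N : ℕ) (a b : ℂ) (h : a ^ N + b ^ N = 1) : curve N :=
  ⟨Projectivization.mk ℂ ![a, b, 1] (affine_ne_zero a b),
    (mk_mem_curve N _ _).2 (by simpa using h)⟩

/-- The linear map `(X, Y, Z) ↦ (aX, bY, Z)`. -/
def diagLin (a b : ℂ) : (Fin 3 → ℂ) →ₗ[ℂ] (Fin 3 → ℂ) where
  toFun v := ![a * v 0, b * v 1, v 2]
  map_add' v w := by
    ext k; fin_cases k <;> simp [mul_add]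
  map_smul' c v := by
    ext k; fin_cases k <;> simp [mul_left_comm]

theorem diagLin_injective {a b : ℂ} (ha : a ≠ 0) (hb : b ≠ 0) :
    Function.Injective (diagLin a b) := by
  intro v w h
  have h0 := congrFun h 0
  have h1 := congrFun h 1
  have h2 := congrFun h 2
  simp only [diagLin, LinearMap.coe_mk, AddHom.coe_mk, Matrix.cons_val_zero,
    Matrix.cons_val_one, Matrix.cons_val] at h0 h1 h2
  ext k
  fin_cases k
  · exact mul_left_cancel₀ ha h0
  · exact mul_left_cancel₀ hb h1
  · exact h2

theorem continuous_diagLin_map {a b : ℂ} (ha : a ≠ 0) (hb : b ≠ 0) :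
    Continuous (Projectivization.map (diagLin a b) (diagLin_injective ha hb) : CP2 → CP2) := by
  have hmk : Continuous (Projectivization.mk' ℂ : {v : Fin 3 → ℂ // v ≠ 0} → CP2) :=
    continuous_coinduced_rng
  refine continuous_coinduced_dom.2 ?_
  have hlin : Continuous (diagLin a b) := (diagLin a b).continuous_of_finiteDimensional
  exact hmk.comp (Continuous.subtype_mk (hlin.comp continuous_subtype_val)
    (fun v => (map_ne_zero_iff _ (diagLin_injective ha hb)).2 v.2))

theorem ne_zero_of_pow_eq_one {N : ℕ} [NeZero N] {a : ℂ} (ha : a ^ N = 1) : a ≠ 0 := by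
  rintro rfl
  simp [NeZero.ne N] at ha

/-- The map `(X : Y : Z) ↦ (aX : bY : Z)` of `F(N)` to itself, for `N`-th roots of unity `a, b`. -/
def diagMap {N : ℕ} [NeZero N] (a b : ℂ) (ha : a ^ N = 1) (hb : b ^ N = 1) (p : curve N) :
    curve N :=
  ⟨Projectivization.map (diagLin a b)
      (diagLin_injective (ne_zero_of_pow_eq_one ha) (ne_zero_of_pow_eq_one hb)) p.1, by
    obtain ⟨p, hp⟩ := p
    induction p using Projectivization.ind with
    | h v hv =>
      rw [mk_mem_curve] at hp
      rw [Projectivization.map_mk, mk_mem_curve]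
      simpa [diagLin, mul_pow, ha, hb] using hp⟩

theorem diagMap_mk {N : ℕ} [NeZero N] (a b : ℂ) (ha : a ^ N = 1) (hb : b ^ N = 1)
    (v : Fin 3 → ℂ) (hv : v ≠ 0) (h : Projectivization.mk ℂ v hv ∈ curve N) :
    (diagMap a b ha hb ⟨Projectivization.mk ℂ v hv, h⟩).1 =
      Projectivization.mk ℂ (diagLin a b v) ((map_ne_zero_iff _ (diagLin_injective
        (ne_zero_of_pow_eq_one ha) (ne_zero_of_pow_eq_one hb))).2 hv) := rfl

theorem diagMap_diagMap {N : ℕ} [NeZero N] (a b c d : ℂ) (ha : a ^ N = 1) (hb : b ^ N = 1)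
    (hc : c ^ N = 1) (hd : d ^ N = 1) (hac : a * c = 1) (hbd : b * d = 1) (p : curve N) :
    diagMap a b ha hb (diagMap c d hc hd p) = p := by
  obtain ⟨p, hp⟩ := p
  induction p using Projectivization.ind with
  | h v hv =>
    refine Subtype.ext ?_
    change Projectivization.mk ℂ (diagLin a b (diagLin c d v)) _ = Projectivization.mk ℂ v hv
    congr 1
    ext k
    fin_cases k <;> simp [diagLin, ← mul_assoc, hac, hbd]

theorem continuous_diagMap {N : ℕ} [NeZero N] (a b : ℂ) (ha : a ^ N = 1) (hb : b ^ N = 1) :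
    Continuous (diagMap a b ha hb : curve N → curve N) :=
  Continuous.subtype_mk ((continuous_diagLin_map (ne_zero_of_pow_eq_one ha)
    (ne_zero_of_pow_eq_one hb)).comp continuous_subtype_val) _

/-- The automorphism `(X : Y : Z) ↦ (aX : bY : Z)` of `F(N)`, for `N`-th roots of unity `a, b`. -/
def diag {N : ℕ} [NeZero N] (a b : ℂ) (ha : a ^ N = 1) (hb : b ^ N = 1) : curve N ≃ₜ curve N where
  toFun := diagMap a b ha hb
  invFun := diagMap a⁻¹ b⁻¹ (by rw [inv_pow, ha, inv_one]) (by rw [inv_pow, hb, inv_one])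
  left_inv := diagMap_diagMap _ _ _ _ _ _ _ _
    (inv_mul_cancel₀ (ne_zero_of_pow_eq_one ha)) (inv_mul_cancel₀ (ne_zero_of_pow_eq_one hb))
  right_inv := diagMap_diagMap _ _ _ _ _ _ _ _
    (mul_inv_cancel₀ (ne_zero_of_pow_eq_one ha)) (mul_inv_cancel₀ (ne_zero_of_pow_eq_one hb))
  continuous_toFun := continuous_diagMap _ _ _ _
  continuous_invFun := continuous_diagMap _ _ _ _

/-- `ζ_N = exp(2π√-1 / N)`. -/
def zeta (N : ℕ) : ℂ := Complex.exp (2 * Real.pi * Complex.I / N)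

theorem zeta_pow (N : ℕ) [NeZero N] : zeta N ^ N = 1 :=
  (Complex.isPrimitiveRoot_exp N (NeZero.ne N)).pow_eq_one

/-- `α(X : Y : Z) = (ζ_N X : Y : Z)`. -/
def alpha (N : ℕ) [NeZero N] : curve N ≃ₜ curve N := diag (zeta N) 1 (zeta_pow N) (one_pow N)

/-- `β(X : Y : Z) = (X : ζ_N Y : Z)`. -/
def beta (N : ℕ) [NeZero N] : curve N ≃ₜ curve N := diag 1 (zeta N) (one_pow N) (zeta_pow N)

/-- `α ^ i β ^ j`, a power and product in the group of self-homeomorphisms. -/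
def aut (N : ℕ) [NeZero N] (i j : ℤ) : curve N ≃ₜ curve N := alpha N ^ i * beta N ^ j

/-- `P_i = α ^ i (1, 0)`. -/
def P (N : ℕ) [NeZero N] (i : ℤ) : curve N :=
  (alpha N ^ i) (affine N 1 0 (by simp [NeZero.ne N]))

/-- `Q_j = β ^ j (0, 1)`. -/
def Q (N : ℕ) [NeZero N] (j : ℤ) : curve N :=
  (beta N ^ j) (affine N 0 1 (by simp [NeZero.ne N]))

theorem zpow_apply_of_fixed {X : Type*} [TopologicalSpace X] (f : X ≃ₜ X) (p : X) (h : f p = p)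
    (i : ℤ) : (f ^ i) p = p := by
  have hinv : f⁻¹ p = p := by
    change f.symm p = p
    rw [Homeomorph.symm_apply_eq, h]
  induction i using Int.induction_on with
  | zero => rfl
  | succ n ih =>
    rw [zpow_add_one]
    change (f ^ (n : ℤ)) (f p) = p
    rw [h, ih]
  | pred n ih =>
    rw [zpow_sub_one]
    change (f ^ (-(n : ℤ))) (f⁻¹ p) = p
    rw [hinv, ih]

theorem alpha_beta_comm (N : ℕ) [NeZero N] : Commute (alpha N) (beta N) := by
  refine Homeomorph.ext fun p => ?_
  obtain ⟨p, hp⟩ := p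
  induction p using Projectivization.ind with
  | h v hv =>
    refine Subtype.ext ?_
    change Projectivization.mk ℂ (diagLin (zeta N) 1 (diagLin 1 (zeta N) v)) _ =
      Projectivization.mk ℂ (diagLin 1 (zeta N) (diagLin (zeta N) 1 v)) _
    congr 1
    ext k
    fin_cases k <;> simp [diagLin]

theorem aut_Q_zero (N : ℕ) [NeZero N] (i j : ℤ) : aut N i j (Q N 0) = Q N j := by
  rw [aut, ((alpha_beta_comm N).zpow_zpow i j).eq]
  change (beta N ^ j) ((alpha N ^ i) (affine N 0 1 (by simp [NeZero.ne N]))) = _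
  refine congrArg _ (zpow_apply_of_fixed _ _ (Subtype.ext ?_) i)
  change Projectivization.mk ℂ (diagLin (zeta N) 1 _) _ = Projectivization.mk ℂ _ _
  congr 1
  ext k
  fin_cases k <;> simp [diagLin]

theorem aut_P_zero (N : ℕ) [NeZero N] (i j : ℤ) : aut N i j (P N 0) = P N i := by
  change (alpha N ^ i) ((beta N ^ j) (affine N 1 0 (by simp [NeZero.ne N]))) = _
  refine congrArg _ (zpow_apply_of_fixed _ _ (Subtype.ext ?_) j)
  change Projectivization.mk ℂ (diagLin 1 (zeta N) _) _ = Projectivization.mk ℂ _ _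
  congr 1
  ext k
  fin_cases k <;> simp [diagLin]

/-- The real nonnegative root `(1 - t ^ N) ^ (1 / N)`. -/
def root (N : ℕ) (t : ℝ) : ℝ := (1 - t ^ N) ^ (1 / (N : ℝ))

theorem root_pow (N : ℕ) [NeZero N] (t : I) :
    ((t : ℝ) : ℂ) ^ N + (root N t : ℂ) ^ N = 1 := by
  have h : 0 ≤ 1 - (t : ℝ) ^ N := sub_nonneg.2 (pow_le_one₀ t.2.1 t.2.2)
  have h2 : root N t ^ N = 1 - (t : ℝ) ^ N := by
    rw [root, one_div, Real.rpow_inv_natCast_pow h (NeZero.ne N)]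
  rw [← Complex.ofReal_pow, ← Complex.ofReal_pow, h2]
  push_cast
  ring

/-- The path `γ_0(t) = (t, (1 - t ^ N) ^ (1 / N))`, from `Q_0` to `P_0`. -/
def gamma0 (N : ℕ) [NeZero N] : Path (Q N 0) (P N 0) where
  toFun t := affine N (t : ℝ) (root N t) (root_pow N t)
  continuous_toFun := by
    have hmk : Continuous (Projectivization.mk' ℂ : {v : Fin 3 → ℂ // v ≠ 0} → CP2) :=
      continuous_coinduced_rng
    refine Continuous.subtype_mk (hmk.comp (Continuous.subtype_mk
      (f := fun t : I => (![((t : ℝ) : ℂ), (root N t : ℂ), 1] : Fin 3 → ℂ)) ?_ fun t =>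
      affine_ne_zero ((t : ℝ) : ℂ) (root N t : ℂ))) _
    refine continuous_pi fun k => ?_
    fin_cases k
    · exact Complex.continuous_ofReal.comp continuous_subtype_val
    · refine Complex.continuous_ofReal.comp ?_
      exact (continuous_const.sub (continuous_subtype_val.pow N)).rpow_const
        fun _ => Or.inr (by positivity)
    · exact continuous_const
  source' := by
    refine Subtype.ext ?_
    change Projectivization.mk ℂ _ _ = Projectivization.mk ℂ _ _
    congr 1
    simp [root, NeZero.ne N]
  target' := by
    refine Subtype.ext ?_
    change Projectivization.mk ℂ _ _ = Projectivization.mk ℂ _ _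
    congr 1
    simp [root, NeZero.ne N]

/-- The path `α ^ i β ^ j γ_0`, from `Q_j` to `P_i`. -/
def autGamma0 (N : ℕ) [NeZero N] (i j : ℤ) : Path (Q N j) (P N i) :=
  ((gamma0 N).map (aut N i j).continuous).cast (aut_Q_zero N i j).symm (aut_P_zero N i j).symm

/-- The loop `κ_0 = γ_0 · (β γ_0)⁻¹ · (α β γ_0) · (α γ_0)⁻¹`. -/
def kappa0 (N : ℕ) [NeZero N] : Path (Q N 0) (Q N 0) :=
  (((gamma0 N).trans (autGamma0 N 0 1).symm).trans (autGamma0 N 1 1)).trans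
    (autGamma0 N 1 0).symm

/-- The loop `α ^ i β ^ j κ_0`, based at `Q_j`. -/
def autKappa0 (N : ℕ) [NeZero N] (i j : ℤ) : Path (Q N j) (Q N j) :=
  ((kappa0 N).map (aut N i j).continuous).cast (aut_Q_zero N i j).symm (aut_Q_zero N i j).symm

/-- The path `γ_j = γ_0 · (β ^ j γ_0)⁻¹`, from `Q_0` to `Q_j`. -/
def gammaPath (N : ℕ) [NeZero N] (j : ℤ) : Path (Q N 0) (Q N j) :=
  (gamma0 N).trans (autGamma0 N 0 j).symm

/-- The loop `γ_{i,j} = γ_j · (α ^ i β ^ j κ_0) · γ_j⁻¹`, based at `Q_0`. -/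
def gammaLoop (N : ℕ) [NeZero N] (i j : ℤ) : Path (Q N 0) (Q N 0) :=
  ((gammaPath N j).trans (autKappa0 N i j)).trans (gammaPath N j).symm

/-- A meromorphic 1-form on `F(N)` is `g dx` for a unique function `g`; it is represented by `g`.
(For a holomorphic form, the formula `g dx` breaks down only at the finitely many points where
`y = 0` or `Z = 0`; this affects pullbacks to a path only on a null set of parameters.) -/
abbrev OneForm (N : ℕ) : Type := curve N → ℂ

/-- `B(r/N, s/N)`. -/
def B (N r s : ℕ) : ℝ := ProbabilityTheory.beta ((r : ℝ) / N) ((s : ℝ) / N)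

/-- `ω'_{r,s} = x ^ (r - 1) y ^ (s - 1) dx / y ^ (N - 1)`. -/
def omega' (N r s : ℕ) : OneForm N := fun p => x p ^ (r - 1) * y p ^ (s - 1) / y p ^ (N - 1)

/-- `ω_{r,s} = N ω'_{r,s} / B(r/N, s/N)`. -/
def omega (N r s : ℕ) : OneForm N := fun p => N * omega' N r s p / (B N r s : ℂ)

/-- The function `f` with `C^* ω = f(t) dt` on `[0,1]`, for `ω = g dx`. -/
def pullback {N : ℕ} {p q : curve N} (C : Path p q) (g : OneForm N) (t : ℝ) : ℂ :=
  g (C.extend t) * deriv (fun u : ℝ => x (C.extend u)) t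

/-- The simplex `0 ≤ t₁ ≤ t₂ ≤ 1`. -/
def simplex : Set (ℝ × ℝ) := {t | 0 ≤ t.1 ∧ t.1 ≤ t.2 ∧ t.2 ≤ 1}

/-- The double integral that defines `∫_C ω₁ ω₂` converges absolutely. -/
def IterIntegrable {N : ℕ} {p q : curve N} (C : Path p q) (w₁ w₂ : OneForm N) : Prop :=
  IntegrableOn (fun t : ℝ × ℝ => pullback C w₁ t.1 * pullback C w₂ t.2) simplex

/-- Chen's iterated integral `∫_C ω₁ ω₂ = ∫_{0 ≤ t₁ ≤ t₂ ≤ 1} f₁(t₁) f₂(t₂) dt₁ dt₂`, where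
`C^* ω_k = f_k(t) dt`. -/
def iterIntegral {N : ℕ} {p q : curve N} (C : Path p q) (w₁ w₂ : OneForm N) : ℂ :=
  ∫ t in simplex, pullback C w₁ t.1 * pullback C w₂ t.2

/-- `f_{r,s} = t ^ (r - 1) ((1 - t ^ N) ^ (1 / N)) ^ (s - N)`. -/
def f (N r s : ℕ) (t : ℝ) : ℝ := t ^ (r - 1) * root N t ^ ((s : ℤ) - N)

/-- The real number `x_{r,s,l,m} = N² ∫_{0 ≤ t₁ ≤ t₂ ≤ 1} f_{r,s}(t₁) f_{l,m}(t₂) dt₁ dt₂ /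
(B(r/N, s/N) B(l/N, m/N))`. -/
def xInt (N r s l m : ℕ) : ℝ :=
  (N : ℝ) ^ 2 * (∫ t in simplex, f N r s t.1 * f N l m t.2) / (B N r s * B N l m)

end FermatCurve

end

noncomputable section

namespace FermatCurve

open MeasureTheory
open scoped unitInterval LinearAlgebra.Projectivization

/-! Every loop in question is a word in the segments $\alpha^i\beta^j\gamma_0$ and their inverses,
so one computation on $\gamma_0$ and three rules suffice. Write $(a,b,c)$ for the integrals of
$\omega_1$, of $\omega_2$, and of $\omega_1\omega_2$ along a path. Concatenation gives
$(a+a',\,b+b',\,c+c'+ab')$ (`HasChen.path_trans`), reversal gives $(-a,-b,ab-c)$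
(`HasChen.path_symm`), and $\alpha^i\beta^j$ multiplies the pullbacks of the two forms by
$\zeta^{ir+js}$ and $\zeta^{il+jm}$ (`HasChen.map_aut`).

On $\gamma_0$ the triple is $(1,1,x_{r,s,l,m})$ (`hasChen_gamma0`): $u=t^N$ turns the single
integrals into beta integrals, which the normalisation of $\omega_{r,s}$ cancels. For $\kappa_0$ the
single integrals are then $(1-\zeta^r)(1-\zeta^s)$ and $(1-\zeta^l)(1-\zeta^m)$. Conjugation by
$\gamma_j$, with single integrals $1-\zeta^{js}$ and $1-\zeta^{jm}$, adds the antisymmetric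
expression $a_{\gamma}b_{\kappa}-a_{\kappa}b_{\gamma}$, which is the last two terms of the formula.
-/

/-- `F` and `G` are integrable on `[0, 1]` with integrals `a` and `b`, and the iterated integral of
`F` followed by `G` is `c`. -/
structure HasChen (F G : ℝ → ℂ) (a b c : ℂ) : Prop where
  int_left : IntervalIntegrable F volume 0 1
  int_right : IntervalIntegrable G volume 0 1
  left_eq : ∫ t in (0 : ℝ)..1, F t = a
  right_eq : ∫ t in (0 : ℝ)..1, G t = b
  iter_eq : ∫ t in (0 : ℝ)..1, (∫ u in (0 : ℝ)..t, F u) * G t = c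

/-! ### Iterated integrals of functions on the unit interval -/

theorem intervalIntegrable_primitive_mul {F G : ℝ → ℂ} (hF : IntervalIntegrable F volume 0 1)
    (hG : IntervalIntegrable G volume 0 1) :
    IntervalIntegrable (fun t => (∫ u in (0 : ℝ)..t, F u) * G t) volume 0 1 :=
  hG.continuousOn_mul
    (intervalIntegral.continuousOn_primitive_interval' hF Set.left_mem_uIcc)

theorem measurableSet_simplex : MeasurableSet simplex := by
  refine IsClosed.measurableSet ?_
  exact (isClosed_le continuous_const continuous_fst).inter
    ((isClosed_le continuous_fst continuous_snd).inter
      (isClosed_le continuous_snd continuous_const))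

theorem integrableOn_simplex {F G : ℝ → ℂ} (hF : IntervalIntegrable F volume 0 1)
    (hG : IntervalIntegrable G volume 0 1) :
    IntegrableOn (fun t : ℝ × ℝ => F t.1 * G t.2) simplex := by
  rw [intervalIntegrable_iff_integrableOn_Icc_of_le zero_le_one] at hF hG
  have h := Integrable.mul_prod hF hG
  rw [Measure.prod_restrict] at h
  exact IntegrableOn.mono_set (t := Set.Icc 0 1 ×ˢ Set.Icc 0 1) h fun t ht =>
    ⟨⟨ht.1, ht.2.1.trans ht.2.2⟩, ⟨ht.1.trans ht.2.1, ht.2.2⟩⟩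

/-- Fubini with $t_2$ outermost: the slice of the simplex at $t_2=t$ is $[0,t]$ for $t\in[0,1]$ and
empty otherwise. -/
theorem integral_simplex {F G : ℝ → ℂ} (hF : IntervalIntegrable F volume 0 1)
    (hG : IntervalIntegrable G volume 0 1) :
    ∫ t in simplex, F t.1 * G t.2 = ∫ t in (0 : ℝ)..1, (∫ u in (0 : ℝ)..t, F u) * G t := by
  have hint := (integrable_indicator_iff measurableSet_simplex).2 (integrableOn_simplex hF hG)
  rw [← integral_indicator measurableSet_simplex, Measure.volume_eq_prod,
    integral_prod_symm _ (by rwa [← Measure.volume_eq_prod]),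
    intervalIntegral.integral_of_le zero_le_one, ← integral_Icc_eq_integral_Ioc,
    ← integral_indicator measurableSet_Icc]
  refine integral_congr_ae (Filter.Eventually.of_forall fun t => ?_)
  by_cases ht : t ∈ Set.Icc (0 : ℝ) 1
  · simp only [Set.indicator_of_mem ht]
    rw [intervalIntegral.integral_of_le ht.1, ← integral_Icc_eq_integral_Ioc,
      ← integral_mul_const, ← integral_indicator measurableSet_Icc]
    refine integral_congr_ae (Filter.Eventually.of_forall fun u => ?_)
    by_cases hu : u ∈ Set.Icc 0 t
    · have : (u, t) ∈ simplex := ⟨hu.1, hu.2, ht.2⟩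
      simp only [Set.indicator_of_mem hu, Set.indicator_of_mem this]
    · have : (u, t) ∉ simplex := fun h => hu ⟨h.1, h.2.1⟩
      simp only [Set.indicator_of_notMem hu, Set.indicator_of_notMem this]
  · simp only [Set.indicator_of_notMem ht]
    refine integral_eq_zero_of_ae (Filter.Eventually.of_forall fun u => ?_)
    have : (u, t) ∉ simplex := fun h => ht ⟨h.1.trans h.2.1, h.2.2⟩
    simp only [Set.indicator_of_notMem this, Pi.zero_apply]

/-- Agreement on the open interval is enough because endpoints are null; there the integrands may be
singular and the paths' extensions stop being smooth. -/
theorem HasChen.congr {F G F' G' : ℝ → ℂ} {a b c : ℂ} (h : HasChen F G a b c)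
    (hF : Set.EqOn F F' (Set.Ioo 0 1)) (hG : Set.EqOn G G' (Set.Ioo 0 1)) :
    HasChen F' G' a b c where
  int_left := h.int_left.congr_uIoo (by rwa [Set.uIoo_of_le zero_le_one])
  int_right := h.int_right.congr_uIoo (by rwa [Set.uIoo_of_le zero_le_one])
  left_eq := by rw [← h.left_eq, intervalIntegral.integral_congr_Ioo_of_le zero_le_one hF]
  right_eq := by rw [← h.right_eq, intervalIntegral.integral_congr_Ioo_of_le zero_le_one hG]
  iter_eq := by
    rw [← h.iter_eq]
    refine intervalIntegral.integral_congr_Ioo_of_le zero_le_one fun t ht => ?_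
    simp only [hG ht]
    rw [intervalIntegral.integral_congr_Ioo_of_le ht.1.le
      fun u hu => hF ⟨hu.1, hu.2.trans ht.2⟩]

theorem HasChen.const_mul {F G : ℝ → ℂ} {a b c : ℂ} (h : HasChen F G a b c) (p q : ℂ) :
    HasChen (fun t => p * F t) (fun t => q * G t) (p * a) (q * b) (p * q * c) where
  int_left := h.int_left.const_mul p
  int_right := h.int_right.const_mul q
  left_eq := by rw [intervalIntegral.integral_const_mul, h.left_eq]
  right_eq := by rw [intervalIntegral.integral_const_mul, h.right_eq]
  iter_eq := by
    rw [← h.iter_eq, ← intervalIntegral.integral_const_mul]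
    refine intervalIntegral.integral_congr fun t _ => ?_
    simp only [intervalIntegral.integral_const_mul]
    ring

/-- The primitive of the reversed $F$ at $t$ is minus the integral of $F$ over $[1-t,1]$, that is,
$\int_0^{1-t}F-a$. The two signs cancel, leaving $\int_0^1(a-\int_0^vF)\,G(v)\,dv=ab-c$. -/
theorem HasChen.reverse {F G : ℝ → ℂ} {a b c : ℂ} (h : HasChen F G a b c) :
    HasChen (fun t => -F (1 - t)) (fun t => -G (1 - t)) (-a) (-b) (a * b - c) where
  int_left := IntervalIntegrable.neg (f := fun t => F (1 - t))
    (by simpa using (h.int_left.comp_sub_left 1).symm)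
  int_right := IntervalIntegrable.neg (f := fun t => G (1 - t))
    (by simpa using (h.int_right.comp_sub_left 1).symm)
  left_eq := by simp [intervalIntegral.integral_comp_sub_left, h.left_eq]
  right_eq := by simp [intervalIntegral.integral_comp_sub_left, h.right_eq]
  iter_eq := by
    have hprim : ∀ t ∈ Set.uIcc (0 : ℝ) 1,
        (∫ u in (0 : ℝ)..t, -F (1 - u)) * -G (1 - t) =
          (fun v => a * G v - (∫ u in (0 : ℝ)..v, F u) * G v) (1 - t) := by
      intro t ht
      rw [Set.uIcc_of_le zero_le_one] at ht
      have h1 : IntervalIntegrable F volume 0 (1 - t) :=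
        h.int_left.mono_set (by
          rw [Set.uIcc_of_le zero_le_one, Set.uIcc_of_le (by linarith [ht.2])]
          exact Set.Icc_subset_Icc_right (by linarith [ht.1]))
      have h2 := intervalIntegral.integral_interval_sub_left h.int_left h1
      rw [h.left_eq] at h2
      simp only [intervalIntegral.integral_neg, intervalIntegral.integral_comp_sub_left, sub_zero,
        ← h2]
      ring
    rw [intervalIntegral.integral_congr hprim,
      intervalIntegral.integral_comp_sub_left
        (fun v => a * G v - (∫ u in (0 : ℝ)..v, F u) * G v) 1]
    simp only [sub_self, sub_zero]
    rw [intervalIntegral.integral_sub (h.int_right.const_mul a)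
      (intervalIntegrable_primitive_mul h.int_left h.int_right),
      intervalIntegral.integral_const_mul, h.right_eq, h.iter_eq]

/-- If `H t = 2 F (2 t - d)` on an interval, its integrals there are those of `F`. -/
theorem integral_of_eqOn_rescale {F H : ℝ → ℂ} {p q d : ℝ} (hpq : p ≤ q)
    (hH : ∀ t ∈ Set.Ioo p q, H t = 2 * F (2 * t - d)) :
    ∫ t in p..q, H t = ∫ t in (2 * p - d)..(2 * q - d), F t := by
  rw [intervalIntegral.integral_congr_Ioo_of_le hpq hH, intervalIntegral.integral_const_mul,
    intervalIntegral.integral_comp_mul_sub F two_ne_zero d, Complex.real_smul, ← mul_assoc]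
  norm_num

theorem intervalIntegrable_of_eqOn_rescale {F H : ℝ → ℂ} {p q d : ℝ} (hpq : p ≤ q)
    (hF : IntervalIntegrable F volume (2 * p - d) (2 * q - d))
    (hH : ∀ t ∈ Set.Ioo p q, H t = 2 * F (2 * t - d)) :
    IntervalIntegrable H volume p q := by
  have h := ((hF.comp_sub_right d).comp_mul_left (c := 2)).const_mul 2
  simp only [sub_add_cancel, mul_div_cancel_left₀ _ (two_ne_zero (α := ℝ))] at h
  refine h.congr_uIoo fun t ht => ?_
  rw [Set.uIoo_of_le hpq] at ht
  exact (hH t ht).symm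

/-- On the second half the primitive of $H$ starts from $a$, the full integral of $F$; this
constant, integrated against $G'$, produces the cross term $ab'$. -/
theorem HasChen.concat {F G F' G' H K : ℝ → ℂ} {a b c a' b' c' : ℂ} (h : HasChen F G a b c)
    (h' : HasChen F' G' a' b' c')
    (hH : ∀ t ∈ Set.Ioo (0 : ℝ) (1 / 2), H t = 2 * F (2 * t))
    (hH' : ∀ t ∈ Set.Ioo (1 / 2 : ℝ) 1, H t = 2 * F' (2 * t - 1))
    (hK : ∀ t ∈ Set.Ioo (0 : ℝ) (1 / 2), K t = 2 * G (2 * t))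
    (hK' : ∀ t ∈ Set.Ioo (1 / 2 : ℝ) 1, K t = 2 * G' (2 * t - 1)) :
    HasChen H K (a + a') (b + b') (c + c' + a * b') := by
  have e0 : (2 * 0 - 0 : ℝ) = 0 := by norm_num
  have e1 : (2 * (1 / 2) - 0 : ℝ) = 1 := by norm_num
  have e2 : (2 * (1 / 2) - 1 : ℝ) = 0 := by norm_num
  have e3 : (2 * 1 - 1 : ℝ) = 1 := by norm_num
  have l0 : (0 : ℝ) ≤ 1 / 2 := by norm_num
  have l1 : (1 / 2 : ℝ) ≤ 1 := by norm_num
  -- Both halves use the same rescaling lemma, with shift $d=0$ on the first and $d=1$ on the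
  -- second.
  replace hH : ∀ t ∈ Set.Ioo (0 : ℝ) (1 / 2), H t = 2 * F (2 * t - 0) := by simpa using hH
  replace hK : ∀ t ∈ Set.Ioo (0 : ℝ) (1 / 2), K t = 2 * G (2 * t - 0) := by simpa using hK
  have iH := intervalIntegrable_of_eqOn_rescale l0 (by rw [e0, e1]; exact h.int_left) hH
  have iK := intervalIntegrable_of_eqOn_rescale l0 (by rw [e0, e1]; exact h.int_right) hK
  have iH' := intervalIntegrable_of_eqOn_rescale l1 (by rw [e2, e3]; exact h'.int_left) hH'
  have iK' := intervalIntegrable_of_eqOn_rescale l1 (by rw [e2, e3]; exact h'.int_right) hK'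
  have sH : ∫ t in (0 : ℝ)..(1 / 2), H t = a := by
    rw [integral_of_eqOn_rescale l0 hH, e0, e1, h.left_eq]
  have sK : ∫ t in (0 : ℝ)..(1 / 2), K t = b := by
    rw [integral_of_eqOn_rescale l0 hK, e0, e1, h.right_eq]
  have sH' : ∫ t in (1 / 2 : ℝ)..1, H t = a' := by
    rw [integral_of_eqOn_rescale l1 hH', e2, e3, h'.left_eq]
  have sK' : ∫ t in (1 / 2 : ℝ)..1, K t = b' := by
    rw [integral_of_eqOn_rescale l1 hK', e2, e3, h'.right_eq]
  have iP := intervalIntegrable_primitive_mul (iH.trans iH') (iK.trans iK')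
  have first : ∫ t in (0 : ℝ)..(1 / 2), (∫ u in (0 : ℝ)..t, H u) * K t = c := by
    rw [integral_of_eqOn_rescale (F := fun v => (∫ u in (0 : ℝ)..v, F u) * G v) (d := 0) l0, e0,
      e1, h.iter_eq]
    intro t ht
    rw [integral_of_eqOn_rescale ht.1.le fun u hu => hH u ⟨hu.1, hu.2.trans ht.2⟩, e0, hK t ht]
    ring
  have second : ∫ t in (1 / 2 : ℝ)..1, (∫ u in (0 : ℝ)..t, H u) * K t = a * b' + c' := by
    rw [integral_of_eqOn_rescale
      (F := fun v => a * G' v + (∫ u in (0 : ℝ)..v, F' u) * G' v) (d := 1) l1, e2, e3,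
      intervalIntegral.integral_add (h'.int_right.const_mul a)
        (intervalIntegrable_primitive_mul h'.int_left h'.int_right),
      intervalIntegral.integral_const_mul, h'.right_eq, h'.iter_eq]
    intro t ht
    have iHt : IntervalIntegrable H volume (1 / 2) t := iH'.mono_set (by
      rw [Set.uIcc_of_le l1, Set.uIcc_of_le ht.1.le]
      exact Set.Icc_subset_Icc_right ht.2.le)
    rw [← intervalIntegral.integral_add_adjacent_intervals iH iHt, sH,
      integral_of_eqOn_rescale ht.1.le fun u hu => hH' u ⟨hu.1, hu.2.trans ht.2⟩, e2, hK' t ht]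
    ring
  refine ⟨iH.trans iH', iK.trans iK', ?_, ?_, ?_⟩
  · rw [← intervalIntegral.integral_add_adjacent_intervals iH iH', sH, sH']
  · rw [← intervalIntegral.integral_add_adjacent_intervals iK iK', sK, sK']
  · have m0 : (1 / 2 : ℝ) ∈ Set.uIcc (0 : ℝ) 1 := by
      rw [Set.uIcc_of_le zero_le_one]; exact ⟨l0, l1⟩
    rw [← intervalIntegral.integral_add_adjacent_intervals
      (iP.mono_set (Set.uIcc_subset_uIcc_left m0)) (iP.mono_set (Set.uIcc_subset_uIcc_right m0)),
      first, second]
    ring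

/-! ### Pullbacks along reversed and concatenated paths -/

section Paths

variable {N : ℕ} {p q q' : curve N}

theorem pullback_symm (C : Path p q) (g : OneForm N) (t : ℝ) :
    pullback C.symm g t = -pullback C g (1 - t) := by
  simp only [pullback, Path.extend_symm_apply]
  rw [deriv_comp_const_sub (fun u => x (C.extend u)) 1 t]
  ring

/-- Strictly before the midpoint the concatenation agrees with $C(2u)$ in a whole neighbourhood, so
the derivative transfers; at the midpoint itself it need not exist. -/
theorem pullback_trans_of_lt_half (C : Path p q) (D : Path q q') (g : OneForm N) {t : ℝ}
    (ht : t < 1 / 2) : pullback (C.trans D) g t = 2 * pullback C g (2 * t) := by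
  have h : (fun u : ℝ => x ((C.trans D).extend u)) =ᶠ[nhds t] fun u => x (C.extend (2 * u)) := by
    filter_upwards [Iio_mem_nhds ht] with u hu
    rw [Path.extend_trans_of_le_half _ _ (le_of_lt hu)]
  rw [pullback, pullback, h.deriv_eq, Path.extend_trans_of_le_half _ _ ht.le,
    deriv_comp_mul_left 2 (fun u => x (C.extend u)) t, Complex.real_smul]
  push_cast
  ring

theorem pullback_trans_of_half_lt (C : Path p q) (D : Path q q') (g : OneForm N) {t : ℝ}
    (ht : 1 / 2 < t) : pullback (C.trans D) g t = 2 * pullback D g (2 * t - 1) := by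
  have h : (fun u : ℝ => x ((C.trans D).extend u)) =ᶠ[nhds t]
      fun u => x (D.extend (2 * u - 1)) := by
    filter_upwards [Ioi_mem_nhds ht] with u hu
    rw [Path.extend_trans_of_half_le _ _ (le_of_lt hu)]
  rw [pullback, pullback, h.deriv_eq, Path.extend_trans_of_half_le _ _ ht.le,
    deriv_comp_mul_left 2 (fun u => x (D.extend (u - 1))) t,
    deriv_comp_sub_const (fun u => x (D.extend u)) 1 (2 * t), Complex.real_smul]
  push_cast
  ring

variable {w₁ w₂ : OneForm N} {a b c a' b' c' : ℂ}

theorem HasChen.path_symm {C : Path p q}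
    (h : HasChen (pullback C w₁) (pullback C w₂) a b c) :
    HasChen (pullback C.symm w₁) (pullback C.symm w₂) (-a) (-b) (a * b - c) :=
  h.reverse.congr (fun t _ => (pullback_symm C w₁ t).symm) fun t _ => (pullback_symm C w₂ t).symm

theorem HasChen.path_trans {C : Path p q} {D : Path q q'}
    (h : HasChen (pullback C w₁) (pullback C w₂) a b c)
    (h' : HasChen (pullback D w₁) (pullback D w₂) a' b' c') :
    HasChen (pullback (C.trans D) w₁) (pullback (C.trans D) w₂) (a + a') (b + b')
      (c + c' + a * b') :=
  h.concat h' (fun _ ht => pullback_trans_of_lt_half C D w₁ ht.2)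
    (fun _ ht => pullback_trans_of_half_lt C D w₁ ht.1)
    (fun _ ht => pullback_trans_of_lt_half C D w₂ ht.2)
    fun _ ht => pullback_trans_of_half_lt C D w₂ ht.1

theorem HasChen.iterIntegrable {C : Path p q}
    (h : HasChen (pullback C w₁) (pullback C w₂) a b c) : IterIntegrable C w₁ w₂ :=
  integrableOn_simplex h.int_left h.int_right

theorem HasChen.iterIntegral_eq {C : Path p q}
    (h : HasChen (pullback C w₁) (pullback C w₂) a b c) : iterIntegral C w₁ w₂ = c :=
  (integral_simplex h.int_left h.int_right).trans h.iter_eq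

end Paths

/-! ### Action of the automorphisms on coordinates and forms -/

section Automorphisms

variable {N : ℕ} [NeZero N]

theorem x_diag (a b : ℂ) (ha : a ^ N = 1) (hb : b ^ N = 1) (p : curve N) :
    x (diag a b ha hb p) = a * x p := by
  obtain ⟨p, hp⟩ := p
  induction p using Projectivization.ind with
  | h v hv =>
    have h := (diagMap a b ha hb ⟨Projectivization.mk ℂ v hv, hp⟩).2
    rw [diagMap_mk] at h
    refine (x_mk _ _ h).trans ?_
    rw [x_mk]
    simp [diagLin, mul_div_assoc]

theorem y_diag (a b : ℂ) (ha : a ^ N = 1) (hb : b ^ N = 1) (p : curve N) :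
    y (diag a b ha hb p) = b * y p := by
  obtain ⟨p, hp⟩ := p
  induction p using Projectivization.ind with
  | h v hv =>
    have h := (diagMap a b ha hb ⟨Projectivization.mk ℂ v hv, hp⟩).2
    rw [diagMap_mk] at h
    refine (y_mk _ _ h).trans ?_
    rw [y_mk]
    simp [diagLin, mul_div_assoc]

theorem zpow_apply_of_semiinvariant {X : Type*} [TopologicalSpace X] (f : X ≃ₜ X) (g : X → ℂ)
    {c : ℂ} (hc : c ≠ 0) (h : ∀ p, g (f p) = c * g p) (i : ℤ) (p : X) :
    g ((f ^ i) p) = c ^ i * g p := by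
  induction i using Int.induction_on generalizing p with
  | zero => simp
  | succ n ih =>
    rw [zpow_add_one, zpow_add_one₀ hc]
    change g ((f ^ (n : ℤ)) (f p)) = _
    rw [ih, h, mul_assoc]
  | pred n ih =>
    rw [zpow_sub_one, zpow_sub_one₀ hc]
    change g ((f ^ (-(n : ℤ))) (f.symm p)) = _
    have hs := h (f.symm p)
    rw [Homeomorph.apply_symm_apply] at hs
    rw [ih, hs, mul_assoc, inv_mul_cancel_left₀ hc]

theorem zeta_ne_zero (N : ℕ) : zeta N ≠ 0 := Complex.exp_ne_zero _

theorem x_aut (i j : ℤ) (p : curve N) : x (aut N i j p) = zeta N ^ i * x p := by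
  change x ((alpha N ^ i) ((beta N ^ j) p)) = _
  rw [zpow_apply_of_semiinvariant (alpha N) x (zeta_ne_zero N) (fun p => x_diag _ _ _ _ p),
    zpow_apply_of_semiinvariant (beta N) x one_ne_zero (fun p => x_diag _ _ _ _ p)]
  simp

theorem y_aut (i j : ℤ) (p : curve N) : y (aut N i j p) = zeta N ^ j * y p := by
  change y ((alpha N ^ i) ((beta N ^ j) p)) = _
  rw [zpow_apply_of_semiinvariant (alpha N) y one_ne_zero (fun p => y_diag _ _ _ _ p),
    zpow_apply_of_semiinvariant (beta N) y (zeta_ne_zero N) (fun p => y_diag _ _ _ _ p)]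
  simp

/-- The factor $x^{r-1}dx$ scales by $\zeta^{ir}$ and $y^{s-1}/y^{N-1}$ by
$\zeta^{j(s-N)}=\zeta^{js}$. Pulling a constant out of `deriv` needs no differentiability, so every
$t$ is allowed. -/
theorem pullback_map_aut {p q p' q' : curve N} (C : Path p q) (i j : ℤ)
    (hp : p' = aut N i j p) (hq : q' = aut N i j q) {r s : ℕ} (hr : 1 ≤ r) (hs : 1 ≤ s) (t : ℝ) :
    pullback ((C.map (aut N i j).continuous).cast hp hq) (omega N r s) t =
      (zeta N ^ i) ^ r * (zeta N ^ j) ^ s * pullback C (omega N r s) t := by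
  have hext : ∀ u : ℝ, ((C.map (aut N i j).continuous).cast hp hq).extend u =
      aut N i j (C.extend u) := fun u => rfl
  have hb : (zeta N ^ j) ≠ 0 := zpow_ne_zero _ (zeta_ne_zero N)
  have hbN : (zeta N ^ j) ^ N = 1 := by
    rw [← zpow_natCast, ← zpow_mul, mul_comm, zpow_mul, zpow_natCast, zeta_pow, one_zpow]
  have hN : N - 1 + 1 = N := Nat.sub_add_cancel (Nat.one_le_iff_ne_zero.2 (NeZero.ne N))
  -- Since $s-1\equiv s+(N-1)\pmod N$, this exposes the power that cancels against the denominator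
  -- $y^{N-1}$.
  have hbs : (zeta N ^ j) ^ (s - 1) = (zeta N ^ j) ^ s * (zeta N ^ j) ^ (N - 1) := by
    apply mul_right_cancel₀ hb
    rw [mul_assoc, ← pow_succ, ← pow_succ, hN, hbN, Nat.sub_add_cancel hs, mul_one]
  have har : (zeta N ^ i) ^ r = (zeta N ^ i) ^ (r - 1) * zeta N ^ i := by
    rw [← pow_succ, Nat.sub_add_cancel hr]
  simp only [pullback, hext, omega, omega', x_aut, y_aut, deriv_const_mul_field', mul_pow, hbs,
    har]
  -- Only the nonzero root of unity is cancelled, so $Z=0$, the value of $y^{N-1}$ where $y$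
  -- vanishes, is harmless.
  have key : ∀ X Y Z : ℂ, (zeta N ^ i) ^ (r - 1) * X *
      ((zeta N ^ j) ^ s * (zeta N ^ j) ^ (N - 1) * Y) / ((zeta N ^ j) ^ (N - 1) * Z) =
      (zeta N ^ i) ^ (r - 1) * (zeta N ^ j) ^ s * (X * Y / Z) := fun X Y Z => by
    rw [← mul_div_assoc, ← mul_div_mul_left _ Z (pow_ne_zero (N - 1) hb)]
    ring
  rw [key]
  ring

end Automorphisms

/-! ### The basic segment and the beta integral -/

section Segment

variable {N : ℕ} [NeZero N]

theorem root_pos {t : ℝ} (ht : t ∈ Set.Ioo (0 : ℝ) 1) : 0 < root N t :=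
  Real.rpow_pos_of_pos (sub_pos.2 (pow_lt_one₀ ht.1.le ht.2 (NeZero.ne N))) _

theorem gamma0_extend {t : ℝ} (ht : t ∈ Set.Icc (0 : ℝ) 1) :
    (gamma0 N).extend t = affine N (t : ℝ) (root N t) (root_pow N ⟨t, ht⟩) :=
  Path.extend_apply _ ht

theorem pullback_gamma0 {r s : ℕ} (hs : 1 ≤ s) {t : ℝ} (ht : t ∈ Set.Ioo (0 : ℝ) 1) :
    pullback (gamma0 N) (omega N r s) t = (N / B N r s : ℂ) * (f N r s t : ℂ) := by
  have hx : (fun u : ℝ => x ((gamma0 N).extend u)) =ᶠ[nhds t] fun u => (u : ℂ) := by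
    filter_upwards [Ioo_mem_nhds ht.1 ht.2] with u hu
    rw [gamma0_extend (Set.Ioo_subset_Icc_self hu), affine, x_mk]
    simp
  have hd : deriv (fun u : ℝ => (u : ℂ)) t = 1 := Complex.ofRealCLM.hasDerivAt.deriv
  have hroot : (root N t : ℂ) ≠ 0 := Complex.ofReal_ne_zero.2 (root_pos ht).ne'
  have hN : 1 ≤ N := Nat.one_le_iff_ne_zero.2 (NeZero.ne N)
  have hz : (root N t : ℂ) ^ ((s : ℤ) - N) =
      (root N t : ℂ) ^ (s - 1) / (root N t : ℂ) ^ (N - 1) := by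
    rw [← zpow_natCast, ← zpow_natCast, ← zpow_sub₀ hroot]
    congr 1
    omega
  rw [pullback, hx.deriv_eq, hd, gamma0_extend (Set.Ioo_subset_Icc_self ht), omega, omega',
    affine, x_mk, y_mk, f]
  push_cast
  rw [hz]
  simp
  ring

theorem image_pow_Ioo : (fun t : ℝ => t ^ N) '' Set.Ioo 0 1 = Set.Ioo 0 1 := by
  ext u
  constructor
  · rintro ⟨t, ht, rfl⟩
    exact ⟨pow_pos ht.1 N, pow_lt_one₀ ht.1.le ht.2 (NeZero.ne N)⟩
  · intro hu
    have hN : (0 : ℝ) < (N : ℝ)⁻¹ := inv_pos.2 (Nat.cast_pos.2 (NeZero.pos N))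
    exact ⟨u ^ (N : ℝ)⁻¹, ⟨Real.rpow_pos_of_pos hu.1 _, Real.rpow_lt_one hu.1.le hu.2 hN⟩,
      Real.rpow_inv_natCast_pow hu.1.le (NeZero.ne N)⟩

/-- The left side is the beta integrand after $u=t^N$, with Jacobian $Nt^{N-1}$; the powers of $t$
combine as $t^{N-1}t^{r-N}=t^{r-1}$. -/
theorem ofReal_f_eq {r s : ℕ} (hr : 1 ≤ r) {t : ℝ} (ht : t ∈ Set.Ioo (0 : ℝ) 1) :
    |(N : ℝ) * t ^ (N - 1)| • (((t ^ N : ℝ) : ℂ) ^ (((r : ℝ) / N : ℝ) - 1 : ℂ) *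
      (1 - ((t ^ N : ℝ) : ℂ)) ^ (((s : ℝ) / N : ℝ) - 1 : ℂ)) = N * (f N r s t : ℂ) := by
  have ht0 := ht.1
  have hN0 : (N : ℝ) ≠ 0 := Nat.cast_ne_zero.2 (NeZero.ne N)
  have hN : 1 ≤ N := Nat.one_le_iff_ne_zero.2 (NeZero.ne N)
  have h1 : 0 < 1 - t ^ N := sub_pos.2 (pow_lt_one₀ ht.1.le ht.2 (NeZero.ne N))
  rw [abs_of_pos (by have := NeZero.pos N; positivity), Complex.real_smul, ← Complex.ofReal_one,
    ← Complex.ofReal_sub, ← Complex.ofReal_sub, ← Complex.ofReal_sub,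
    ← Complex.ofReal_cpow (by positivity), ← Complex.ofReal_cpow h1.le, ← Complex.ofReal_mul,
    ← Complex.ofReal_mul, ← Complex.ofReal_natCast, ← Complex.ofReal_mul]
  congr 1
  have e1 : (t ^ N) ^ ((r : ℝ) / N - 1) = t ^ ((r : ℝ) - N) := by
    rw [← Real.rpow_natCast, ← Real.rpow_mul ht0.le]
    congr 1
    field_simp
  have e2 : root N t ^ ((s : ℤ) - N) = (1 - t ^ N) ^ ((s : ℝ) / N - 1) := by
    rw [root, ← Real.rpow_intCast, ← Real.rpow_mul h1.le]
    congr 1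
    push_cast
    field_simp
  have e3 : t ^ (N - 1) * t ^ ((r : ℝ) - N) = t ^ (r - 1) := by
    rw [← Real.rpow_natCast, ← Real.rpow_natCast, ← Real.rpow_add ht0]
    congr 1
    push_cast [hr, hN]
    ring
  rw [f, e1, e2, ← e3]
  ring

theorem injOn_natPow_Ioo : Set.InjOn (fun t : ℝ => t ^ N) (Set.Ioo 0 1) :=
  fun _ ha _ hb h => (pow_left_inj₀ ha.1.le hb.1.le (NeZero.ne N)).1 h

/-- Convergence is inherited from the beta integral, whose parameters $r/N$ and $s/N$ are positive.
-/
theorem intervalIntegrable_f {r s : ℕ} (hr : 1 ≤ r) (hs : 1 ≤ s) :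
    IntervalIntegrable (fun t => (N : ℂ) * (f N r s t : ℂ)) volume 0 1 := by
  have hN : (0 : ℝ) < N := Nat.cast_pos.2 (NeZero.pos N)
  have hr0 : (0 : ℝ) < r := Nat.cast_pos.2 hr
  have hs0 : (0 : ℝ) < s := Nat.cast_pos.2 hs
  have h := Complex.betaIntegral_convergent (u := ((r : ℝ) / N : ℝ)) (v := ((s : ℝ) / N : ℝ))
    (by rw [Complex.ofReal_re]; positivity) (by rw [Complex.ofReal_re]; positivity)
  rw [intervalIntegrable_iff_integrableOn_Ioo_of_le zero_le_one] at h ⊢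
  rw [← image_pow_Ioo (N := N), integrableOn_image_iff_integrableOn_abs_deriv_smul
    measurableSet_Ioo (fun t _ => (hasDerivAt_pow N t).hasDerivWithinAt) injOn_natPow_Ioo] at h
  exact h.congr_fun (fun t ht => ofReal_f_eq hr ht) measurableSet_Ioo

theorem integral_f {r s : ℕ} (hr : 1 ≤ r) (hs : 1 ≤ s) :
    ∫ t in (0 : ℝ)..1, (N : ℂ) * (f N r s t : ℂ) = B N r s := by
  have hN : (0 : ℝ) < N := Nat.cast_pos.2 (NeZero.pos N)
  have hr0 : (0 : ℝ) < (r : ℝ) / N := div_pos (Nat.cast_pos.2 hr) hN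
  have hs0 : (0 : ℝ) < (s : ℝ) / N := div_pos (Nat.cast_pos.2 hs) hN
  have hB : (B N r s : ℂ) = Complex.betaIntegral ((r : ℝ) / N : ℝ) ((s : ℝ) / N : ℝ) := by
    rw [Complex.betaIntegral_eq_Gamma_mul_div _ _ (by rwa [Complex.ofReal_re])
      (by rwa [Complex.ofReal_re]), ← Complex.ofReal_add, Complex.Gamma_ofReal,
      Complex.Gamma_ofReal, Complex.Gamma_ofReal, B, ProbabilityTheory.beta]
    push_cast
    rfl
  rw [hB, Complex.betaIntegral, intervalIntegral.integral_of_le zero_le_one,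
    intervalIntegral.integral_of_le zero_le_one, integral_Ioc_eq_integral_Ioo,
    integral_Ioc_eq_integral_Ioo]
  conv_rhs => rw [← image_pow_Ioo (N := N)]
  rw [integral_image_eq_integral_abs_deriv_smul
    measurableSet_Ioo (fun t _ => (hasDerivAt_pow N t).hasDerivWithinAt) injOn_natPow_Ioo]
  exact setIntegral_congr_fun measurableSet_Ioo fun t ht => (ofReal_f_eq hr ht).symm

theorem B_ne_zero {r s : ℕ} (hr : 1 ≤ r) (hs : 1 ≤ s) : (B N r s : ℂ) ≠ 0 := by
  have hN : (0 : ℝ) < N := Nat.cast_pos.2 (NeZero.pos N)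
  exact Complex.ofReal_ne_zero.2 (ProbabilityTheory.beta_pos (div_pos (Nat.cast_pos.2 hr) hN)
    (div_pos (Nat.cast_pos.2 hs) hN)).ne'

theorem hasChen_gamma0 {r s l m : ℕ} (hr : 1 ≤ r) (hs : 1 ≤ s) (hl : 1 ≤ l) (hm : 1 ≤ m) :
    HasChen (pullback (gamma0 N) (omega N r s)) (pullback (gamma0 N) (omega N l m)) 1 1
      (xInt N r s l m) := by
  have h1 := intervalIntegrable_f (N := N) hr hs
  have h2 := intervalIntegrable_f (N := N) hl hm
  have h := HasChen.const_mul ⟨h1, h2, integral_f hr hs, integral_f hl hm, rfl⟩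
    (B N r s : ℂ)⁻¹ (B N l m : ℂ)⁻¹
  rw [inv_mul_cancel₀ (B_ne_zero hr hs), inv_mul_cancel₀ (B_ne_zero hl hm)] at h
  -- `xInt` is a real integral over the simplex; it is moved to $\mathbb{C}$ and matched with the
  -- nested integral, one factor $N$ going to each form.
  have hX : (xInt N r s l m : ℂ) = (B N r s : ℂ)⁻¹ * (B N l m : ℂ)⁻¹ *
      ∫ t in (0 : ℝ)..1, (∫ u in (0 : ℝ)..t, (N : ℂ) * (f N r s u : ℂ)) *
        ((N : ℂ) * (f N l m t : ℂ)) := by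
    rw [← integral_simplex h1 h2, xInt]
    push_cast
    rw [← integral_complex_ofReal]
    have : ∀ t : ℝ × ℝ, (N : ℂ) * (f N r s t.1 : ℂ) * ((N : ℂ) * (f N l m t.2 : ℂ)) =
        (N : ℂ) ^ 2 * ((f N r s t.1 * f N l m t.2 : ℝ) : ℂ) := fun t => by push_cast; ring
    simp only [this]
    rw [integral_const_mul]
    ring
  rw [hX]
  refine h.congr (fun t ht => ?_) fun t ht => ?_
  · rw [pullback_gamma0 hs ht]
    ring
  · rw [pullback_gamma0 hm ht]
    ring

theorem HasChen.map_aut {p q p' q' : curve N} {C : Path p q} {r s l m : ℕ} {a b c : ℂ}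
    (h : HasChen (pullback C (omega N r s)) (pullback C (omega N l m)) a b c)
    (hr : 1 ≤ r) (hs : 1 ≤ s) (hl : 1 ≤ l) (hm : 1 ≤ m) (i j : ℤ)
    (hp : p' = aut N i j p) (hq : q' = aut N i j q) :
    HasChen (pullback ((C.map (aut N i j).continuous).cast hp hq) (omega N r s))
      (pullback ((C.map (aut N i j).continuous).cast hp hq) (omega N l m))
      ((zeta N ^ i) ^ r * (zeta N ^ j) ^ s * a) ((zeta N ^ i) ^ l * (zeta N ^ j) ^ m * b)
      ((zeta N ^ i) ^ r * (zeta N ^ j) ^ s * ((zeta N ^ i) ^ l * (zeta N ^ j) ^ m) * c) :=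
  (h.const_mul _ _).congr (fun t _ => (pullback_map_aut C i j hp hq hr hs t).symm)
    fun t _ => (pullback_map_aut C i j hp hq hl hm t).symm

end Segment

end FermatCurve

end

/-! ### Assembling the loop -/

open FermatCurve in
theorem mainTheorem2 (N : ℕ) [NeZero N] (hN : 3 ≤ N) (r s l m : ℕ)
    (hr : 1 ≤ r) (hs : 1 ≤ s) (hrs : r + s ≤ N - 1)
    (hl : 1 ≤ l) (hm : 1 ≤ m) (hlm : l + m ≤ N - 1) (i j : ℤ) :
    (IterIntegrable (gamma0 N) (omega N r s) (omega N l m) ∧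
      iterIntegral (gamma0 N) (omega N r s) (omega N l m) = (xInt N r s l m : ℂ)) ∧
    IterIntegrable (gammaLoop N i j) (omega N r s) (omega N l m) ∧
      iterIntegral (gammaLoop N i j) (omega N r s) (omega N l m) =
        zeta N ^ (i * (r + l) + j * (s + m)) *
            ((1 - zeta N ^ (l + r)) * (1 - zeta N ^ (m + s)) * (xInt N r s l m : ℂ) +
              (1 - zeta N ^ s) *
                (zeta N ^ (l + r) + zeta N ^ (l + m) - zeta N ^ m - zeta N ^ l)) +
          (1 - zeta N ^ (j * s)) * (1 - zeta N ^ l) * (1 - zeta N ^ m) *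
            zeta N ^ (i * l + j * m) -
          (1 - zeta N ^ (j * m)) * (1 - zeta N ^ r) * (1 - zeta N ^ s) *
            zeta N ^ (i * r + j * s) := by
  have h0 := hasChen_gamma0 (N := N) hr hs hl hm
  have hg (i j : ℤ) := h0.map_aut hr hs hl hm i j (aut_Q_zero N i j).symm (aut_P_zero N i j).symm
  -- The bracketing of the word must follow `kappa0` exactly: the results are about concrete
  -- parametrised paths, and no homotopy invariance is invoked.
  have hk := ((h0.path_trans (hg 0 1).path_symm).path_trans (hg 1 1)).path_trans
    (hg 1 0).path_symm
  have hk' := hk.map_aut hr hs hl hm i j (aut_Q_zero N i j).symm (aut_Q_zero N i j).symm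
  have hj := h0.path_trans (hg 0 j).path_symm
  have hloop := (hj.path_trans hk').path_trans hj.path_symm
  refine ⟨⟨h0.iterIntegrable, h0.iterIntegral_eq⟩,
    HasChen.iterIntegrable (C := gammaLoop N i j) hloop,
    (HasChen.iterIntegral_eq (C := gammaLoop N i j) hloop).trans ?_⟩
  have hz := zeta_ne_zero N
  -- With all exponents split, the claim is a polynomial identity in powers of $\zeta$, $\zeta^i$,
  -- $\zeta^j$ and in $x_{r,s,l,m}$; the relation $\zeta^N=1$ is no longer needed.
  simp only [zpow_zero, zpow_one, one_pow, one_mul, mul_one, zpow_add₀ hz, mul_add, zpow_mul,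
    zpow_natCast, pow_add]
  ring
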